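/- Let \(n \ge 2\) be an integer and, for each \(p \in [0,1]\), let \(B_{n,p}\) be a random variable with the binomial distribution \(\mathrm{Bin}(n,p)\), that is, \(\mathbb{P}(B_{n,p} = k) = \binom{n}{k} p^k (1-p)^{n-k}\) for \(k = 0, 1, \dots, n\). Then the mapping \(p \mapsto \mathbb{P}(B_{n,p} > np - p)\) is increasing (in the weak sense) on the set of points \(p = \frac{k}{n-1}\), \(k = 1, \dots, n-2\) (a set which is empty for \(n = 2\)), and the mapping \(p \mapsto \mathbb{P}(B_{n,p} > np - (1-p))\) is decreasing (in the weak sense) on the set of points \(p = \frac{k}{n+1}\), \(k = 1, \dots, n\). -/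

import Mathlib

/-! Put n = m + 1. At the chosen points both thresholds are integers, so each claim compares F(k, x)
with F(k + 1, y) at consecutive points x < y, F being the distribution function. Since F(k + 1, y) -
F(k, y) is the mass at k + 1 and -∂F/∂p is a multiple of the beta kernel t^k (1 - t)^(m - k), the
issue is whether the kernel's integral over [x, y] is at least (`binomialCDF_step_mode`) or at most
(`binomialCDF_step_mean`) that mass. The lower bound uses monotonicity past the mode, the upper
bound log-concavity. -/

/-- The distribution function `P(Bin(n, p) ≤ k)` as a polynomial function of `p`. -/
noncomputable def binomialCDF (n k : ℕ) (p : ℝ) : ℝ :=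
  ∑ i ∈ Finset.range (k + 1), (n.choose i : ℝ) * p ^ i * (1 - p) ^ (n - i)

lemma binomialCDF_succ (n k : ℕ) (p : ℝ) :
    binomialCDF n (k + 1) p =
      binomialCDF n k p + (n.choose (k + 1) : ℝ) * p ^ (k + 1) * (1 - p) ^ (n - (k + 1)) :=
  Finset.sum_range_succ _ _

lemma hasDerivAt_bernstein (n i : ℕ) (t : ℝ) :
    HasDerivAt (fun p : ℝ => (n.choose i : ℝ) * p ^ i * (1 - p) ^ (n - i))
      ((Polynomial.derivative (bernsteinPolynomial ℝ n i)).eval t) t := by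
  simpa [bernsteinPolynomial] using (bernsteinPolynomial ℝ n i).hasDerivAt t

/-- The derivatives of the Bernstein terms telescope. -/
lemma hasDerivAt_binomialCDF (m k : ℕ) (t : ℝ) :
    HasDerivAt (binomialCDF (m + 1) k)
      (-(((m : ℝ) + 1) * (m.choose k) * (t ^ k * (1 - t) ^ (m - k)))) t := by
  induction k with
  | zero =>
    have h := hasDerivAt_bernstein (m + 1) 0 t
    rw [bernsteinPolynomial.derivative_zero] at h
    have e : binomialCDF (m + 1) 0 =
        fun p : ℝ => ((m + 1).choose 0 : ℝ) * p ^ 0 * (1 - p) ^ (m + 1 - 0) := by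
      ext p; simp [binomialCDF]
    rw [e]
    refine h.congr_deriv ?_
    simp [bernsteinPolynomial]
    ring
  | succ k ih =>
    have h := ih.add (hasDerivAt_bernstein (m + 1) (k + 1) t)
    rw [bernsteinPolynomial.derivative_succ] at h
    have e : binomialCDF (m + 1) (k + 1) = binomialCDF (m + 1) k +
        fun p : ℝ => ((m + 1).choose (k + 1) : ℝ) * p ^ (k + 1) * (1 - p) ^ (m + 1 - (k + 1)) := by
      ext p; exact binomialCDF_succ _ _ _
    rw [e]
    refine h.congr_deriv ?_
    simp [bernsteinPolynomial]
    ring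

/-- The beta kernel is dominated by the exponential of the tangent to its logarithm. -/
lemma pow_mul_one_sub_pow_le_exp (a b : ℕ) {t y : ℝ} (ht0 : 0 ≤ t) (ht1 : t ≤ 1)
    (hy0 : 0 < y) (hy1 : y < 1) :
    t ^ a * (1 - t) ^ b ≤
      y ^ a * (1 - y) ^ b * Real.exp ((y - t) * (b / (1 - y) - a / y)) := by
  have hy2 : 0 < 1 - y := by linarith
  have h1 : t ≤ y * Real.exp (t / y - 1) := by
    have := Real.add_one_le_exp (t / y - 1)
    calc t = y * (t / y - 1 + 1) := by field_simp; ring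
      _ ≤ _ := by gcongr
  have h2 : 1 - t ≤ (1 - y) * Real.exp ((1 - t) / (1 - y) - 1) := by
    have := Real.add_one_le_exp ((1 - t) / (1 - y) - 1)
    calc 1 - t = (1 - y) * ((1 - t) / (1 - y) - 1 + 1) := by field_simp; ring
      _ ≤ _ := by gcongr
  calc t ^ a * (1 - t) ^ b
      ≤ (y * Real.exp (t / y - 1)) ^ a * ((1 - y) * Real.exp ((1 - t) / (1 - y) - 1)) ^ b := by
        have : 0 ≤ 1 - t := by linarith
        gcongr
    _ = y ^ a * (1 - y) ^ b *
        Real.exp (a * (t / y - 1) + b * ((1 - t) / (1 - y) - 1)) := by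
        rw [Real.exp_add, Real.exp_nat_mul, Real.exp_nat_mul, mul_pow, mul_pow]; ring
    _ = _ := by
        congr 2
        field_simp
        ring

lemma exp_two_div_le {a : ℝ} (ha : 0 < a) : Real.exp (2 / (a + 1)) ≤ 1 + 2 / a := by
  have h := Real.le_log_one_add_of_nonneg (x := 2 / a) (by positivity)
  rw [Real.le_log_iff_exp_le (by positivity)] at h
  refine le_trans (le_of_eq ?_) h
  congr 1
  field_simp
  ring

lemma succ_mul_choose_succ_cast (m k : ℕ) :
    ((m : ℝ) + 1) * (m.choose k) = ((m + 1).choose (k + 1)) * ((k : ℝ) + 1) := by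
  exact_mod_cast Nat.add_one_mul_choose_eq m k

/-- Past its mode, the beta kernel is antitone. -/
lemma pow_mul_one_sub_pow_antitone (a b : ℕ) {t y : ℝ} (ht0 : 0 < t) (hty : t ≤ y) (hy1 : y ≤ 1)
    (ht1 : t < 1) (hmode : (a : ℝ) ≤ (a + b) * t) :
    y ^ a * (1 - y) ^ b ≤ t ^ a * (1 - t) ^ b := by
  have h2 : 0 < 1 - t := by linarith
  -- The tangent is taken at `t`, where `hmode` makes the log-derivative nonpositive.
  refine (pow_mul_one_sub_pow_le_exp a b (ht0.le.trans hty) hy1 ht0 ht1).trans ?_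
  refine mul_le_of_le_one_right (by positivity) (Real.exp_le_one_iff.2 ?_)
  refine mul_nonpos_of_nonpos_of_nonneg (by linarith) (sub_nonneg.2 ?_)
  rw [div_le_div_iff₀ ht0 h2]
  linarith

lemma binomialCDF_step_mode (m k : ℕ) (hk : 1 ≤ k) (hkm : k + 1 < m) :
    binomialCDF (m + 1) (k + 1) (((k + 1 : ℕ) : ℝ) / m) ≤ binomialCDF (m + 1) k ((k : ℝ) / m) := by
  have hm : (0 : ℝ) < m := by exact_mod_cast (by omega : 0 < m)
  have hk0 : (0 : ℝ) < k := by exact_mod_cast hk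
  have hkm' : (k : ℝ) + 1 < m := by exact_mod_cast hkm
  push_cast
  set x : ℝ := (k : ℝ) / m with hx
  set y : ℝ := ((k : ℝ) + 1) / m with hy
  have hx0 : 0 < x := by positivity
  have hxy : x ≤ y := by rw [hx, hy]; gcongr; linarith
  have hy1 : y < 1 := by rw [hy, div_lt_one hm]; exact hkm'
  -- Here `x` is the kernel's mode, so `G`, the value at `y`, is its minimum on [x, y].
  set G : ℝ := ((m : ℝ) + 1) * (m.choose k) * (y ^ k * (1 - y) ^ (m - k))
  have hmono : AntitoneOn (fun t => binomialCDF (m + 1) k t + G * t) (Set.Icc x y) := by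
    have hd : ∀ t, HasDerivAt (fun t => binomialCDF (m + 1) k t + G * t)
        (-(((m : ℝ) + 1) * (m.choose k) * (t ^ k * (1 - t) ^ (m - k))) + G * 1) t := fun t =>
      (hasDerivAt_binomialCDF m k t).add ((hasDerivAt_id t).const_mul G)
    refine antitoneOn_of_hasDerivWithinAt_nonpos (convex_Icc x y)
      (fun t _ => (hd t).continuousAt.continuousWithinAt)
      (fun t _ => (hd t).hasDerivWithinAt) fun t ht => ?_
    rw [interior_Icc] at ht
    have hg : y ^ k * (1 - y) ^ (m - k) ≤ t ^ k * (1 - t) ^ (m - k) := by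
      refine pow_mul_one_sub_pow_antitone k (m - k) (hx0.trans ht.1) ht.2.le hy1.le
        (ht.2.trans hy1) ?_
      rw [Nat.cast_sub (by omega), add_sub_cancel]
      have := ht.1
      rw [hx, div_lt_iff₀ hm] at this
      linarith
    have : G ≤ ((m : ℝ) + 1) * (m.choose k) * (t ^ k * (1 - t) ^ (m - k)) :=
      mul_le_mul_of_nonneg_left hg (by positivity)
    linarith
  have h := hmono (Set.left_mem_Icc.2 hxy) (Set.right_mem_Icc.2 hxy) hxy
  -- The rectangle of height `G` over [x, y] has exactly the area of the added mass.
  have hpmf : ((m + 1).choose (k + 1) : ℝ) * y ^ (k + 1) * (1 - y) ^ (m + 1 - (k + 1)) =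
      G * y - G * x := by
    have e : G * y - G * x = G / m := by rw [hx, hy]; field_simp; ring
    rw [e]
    simp only [G]
    rw [succ_mul_choose_succ_cast, Nat.add_sub_add_right, pow_succ]
    have : y * m = k + 1 := by rw [hy]; field_simp
    rw [← this]
    field_simp
  rw [binomialCDF_succ, hpmf]
  linarith

lemma binomialCDF_step_mean (m j : ℕ) (hjm : j + 1 ≤ m) :
    binomialCDF (m + 1) j (((j + 1 : ℕ) : ℝ) / (m + 2)) ≤
      binomialCDF (m + 1) (j + 1) (((j + 2 : ℕ) : ℝ) / (m + 2)) := by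
  have hjm' : (j : ℝ) + 1 ≤ m := by exact_mod_cast hjm
  have hj0 : (0 : ℝ) ≤ j := by positivity
  push_cast
  set N : ℝ := (m : ℝ) + 2 with hN
  have hN0 : 0 < N := by positivity
  set x : ℝ := ((j : ℝ) + 1) / N with hx
  set y : ℝ := ((j : ℝ) + 2) / N with hy
  have hx0 : 0 < x := by positivity
  have hy0 : 0 < y := by positivity
  have hxy : x ≤ y := by rw [hx, hy]; gcongr; linarith
  have hy1 : y < 1 := by rw [hy, div_lt_one hN0]; linarith
  have hy2 : 0 < 1 - y := by linarith
  -- Minus the log-derivative of the kernel at `y`.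
  set c : ℝ := 2 * N / (j + 2) with hc
  have hc0 : 0 < c := by positivity
  set G : ℝ := ((m : ℝ) + 1) * (m.choose j) * (y ^ j * (1 - y) ^ (m - j)) with hG
  have hG0 : 0 ≤ G := by positivity
  have hslope : ((m - j : ℕ) : ℝ) / (1 - y) - j / y = c := by
    have e1 : 1 - y = ((m : ℝ) - j) / N := by rw [hy]; field_simp; rw [hN]; ring
    have : (m : ℝ) - j ≠ 0 := by linarith
    rw [Nat.cast_sub (by omega), e1, hy, hc]
    field_simp
    ring
  -- Integrated form of kernel ≤ G exp(c (y - t)).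
  have hmono : MonotoneOn
      (fun t => binomialCDF (m + 1) j t - G / c * Real.exp (c * (y - t))) (Set.Icc x y) := by
    have hd : ∀ t, HasDerivAt
        (fun t => binomialCDF (m + 1) j t - G / c * Real.exp (c * (y - t)))
        (-(((m : ℝ) + 1) * (m.choose j) * (t ^ j * (1 - t) ^ (m - j))) -
          G / c * (Real.exp (c * (y - t)) * (c * -1))) t := fun t =>
      (hasDerivAt_binomialCDF m j t).sub
        ((((hasDerivAt_id t).const_sub y).const_mul c).exp.const_mul (G / c))
    refine monotoneOn_of_hasDerivWithinAt_nonneg (convex_Icc x y)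
      (fun t _ => (hd t).continuousAt.continuousWithinAt)
      (fun t _ => (hd t).hasDerivWithinAt) fun t ht => ?_
    rw [interior_Icc] at ht
    have hg := pow_mul_one_sub_pow_le_exp j (m - j) (hx0.trans ht.1).le (ht.2.trans hy1).le hy0 hy1
    rw [hslope, mul_comm (y - t) c] at hg
    have h1 : ((m : ℝ) + 1) * (m.choose j) * (t ^ j * (1 - t) ^ (m - j)) ≤
        G * Real.exp (c * (y - t)) := by
      rw [hG, mul_assoc _ (y ^ j * _)]
      exact mul_le_mul_of_nonneg_left hg (by positivity)
    have h2 : G / c * (Real.exp (c * (y - t)) * (c * -1)) = -(G * Real.exp (c * (y - t))) := by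
      field_simp
    linarith
  have h := hmono (Set.left_mem_Icc.2 hxy) (Set.right_mem_Icc.2 hxy) hxy
  simp only [sub_self, mul_zero, Real.exp_zero, mul_one] at h
  have hcxy : c * (y - x) = 2 / ((j + 1 : ℝ) + 1) := by
    rw [hc, hx, hy]; field_simp; ring
  have hexp : Real.exp (c * (y - x)) ≤ 1 + 2 / ((j : ℝ) + 1) := by
    rw [hcxy]; exact exp_two_div_le (by positivity)
  have h3 : G / c * Real.exp (c * (y - x)) ≤ G / c * (1 + 2 / ((j : ℝ) + 1)) := by gcongr
  have hpmf : ((m + 1).choose (j + 1) : ℝ) * y ^ (j + 1) * (1 - y) ^ (m + 1 - (j + 1)) =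
      G / c * (2 / ((j : ℝ) + 1)) := by
    have e : G / c * (2 / ((j : ℝ) + 1)) = G * y / (j + 1) := by
      rw [hc, hy]; field_simp
    rw [e, hG, succ_mul_choose_succ_cast, Nat.add_sub_add_right, pow_succ]
    field_simp
  rw [binomialCDF_succ, hpmf]
  linarith

lemma binomial_real_Ioi (n k : ℕ) (p : unitInterval) :
    (ProbabilityTheory.binomial n p).real (Set.Ioi k) = 1 - binomialCDF n k p := by
  have h : (ProbabilityTheory.binomial n p).real (Set.Iic k) = binomialCDF n k p := by
    have e : (Set.Iic k) = ((Finset.range (k + 1) : Finset ℕ) : Set ℕ) := by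
      ext i; simp
    rw [e, ← MeasureTheory.sum_measureReal_singleton, binomialCDF]
    simp_rw [ProbabilityTheory.binomial_real_singleton]
  rw [← h, ← Set.compl_Iic, MeasureTheory.probReal_compl_eq_one_sub measurableSet_Iic]

lemma hasLaw_binomial_real_lt {Ω : Type*} [MeasurableSpace Ω] {P : MeasureTheory.Measure Ω}
    {B : Ω → ℕ} {n : ℕ} {p : unitInterval}
    (hB : ProbabilityTheory.HasLaw B (ProbabilityTheory.binomial n p) P) (k : ℕ) :
    P.real {ω | (k : ℝ) < (B ω : ℝ)} = 1 - binomialCDF n k p := by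
  rw [← binomial_real_Ioi, ← hB.map_eq,
    MeasureTheory.map_measureReal_apply_of_aemeasurable hB.aemeasurable measurableSet_Ioi]
  congr 1
  ext ω
  simp

theorem corollary12 (n : ℕ) (hn : 2 ≤ n)
    {Ω : unitInterval → Type*} [∀ p, MeasurableSpace (Ω p)]
    (P : ∀ p, MeasureTheory.Measure (Ω p)) [∀ p, MeasureTheory.IsProbabilityMeasure (P p)]
    (B : ∀ p, Ω p → ℕ)
    (hB : ∀ p, ProbabilityTheory.HasLaw (B p) (ProbabilityTheory.binomial n p) (P p)) :
    MonotoneOn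
      (fun p : unitInterval => (P p).real {ω | (n : ℝ) * (p : ℝ) - (p : ℝ) < (B p ω : ℝ)})
      {p : unitInterval | ∃ k : ℕ, 1 ≤ k ∧ k + 2 ≤ n ∧ (p : ℝ) = (k : ℝ) / ((n : ℝ) - 1)} ∧
    AntitoneOn
      (fun p : unitInterval => (P p).real {ω | (n : ℝ) * (p : ℝ) - (1 - (p : ℝ)) < (B p ω : ℝ)})
      {p : unitInterval | ∃ k : ℕ, 1 ≤ k ∧ k ≤ n ∧ (p : ℝ) = (k : ℝ) / ((n : ℝ) + 1)} := by
  obtain ⟨m, rfl⟩ : ∃ m, n = m + 1 := ⟨n - 1, by omega⟩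
  have hm : (0 : ℝ) < m := by exact_mod_cast (by omega : 0 < m)
  constructor
  · rintro p ⟨k, hk, hkn, hp⟩ q ⟨l, hl, hln, hq⟩ hpq
    have hpq' : (p : ℝ) ≤ q := hpq
    push_cast at hp hq
    rw [add_sub_cancel_right] at hp hq
    have hkl : k ≤ l := by
      rw [hp, hq, div_le_div_iff_of_pos_right hm] at hpq'
      exact_mod_cast hpq'
    have key : ∀ (r : unitInterval) (i : ℕ), (r : ℝ) = i / m →
        (P r).real {ω | ((m + 1 : ℕ) : ℝ) * (r : ℝ) - (r : ℝ) < (B r ω : ℝ)} =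
          1 - binomialCDF (m + 1) i (i / m) := by
      intro r i hr
      rw [← hr, ← hasLaw_binomial_real_lt (hB r) i]
      have : ((m + 1 : ℕ) : ℝ) * (r : ℝ) - (r : ℝ) = i := by
        rw [hr]; push_cast; field_simp; ring
      rw [this]
    have hmono : ∀ l, k ≤ l → l + 1 ≤ m →
        binomialCDF (m + 1) l ((l : ℝ) / m) ≤ binomialCDF (m + 1) k ((k : ℝ) / m) := by
      intro l hkl
      induction l, hkl using Nat.le_induction with
      | base => exact fun _ => le_rfl
      | succ l hkl ih =>
        exact fun h => (binomialCDF_step_mode m l (hk.trans hkl) (by omega)).trans (ih (by omega))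
    simp only [key p k hp, key q l hq]
    linarith [hmono l hkl (by omega)]
  · rintro p ⟨k, hk, hkn, hp⟩ q ⟨l, hl, hln, hq⟩ hpq
    obtain ⟨k, rfl⟩ : ∃ j, k = j + 1 := ⟨k - 1, by omega⟩
    obtain ⟨l, rfl⟩ : ∃ j, l = j + 1 := ⟨l - 1, by omega⟩
    have hN : ((m + 1 : ℕ) : ℝ) + 1 = m + 2 := by push_cast; ring
    have hpq' : (p : ℝ) ≤ q := hpq
    rw [hN] at hp hq
    have hkl : k ≤ l := by
      rw [hp, hq, div_le_div_iff_of_pos_right (by positivity)] at hpq'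
      have : k + 1 ≤ l + 1 := by exact_mod_cast hpq'
      omega
    have key : ∀ (r : unitInterval) (i : ℕ), (r : ℝ) = ((i + 1 : ℕ) : ℝ) / (m + 2) →
        (P r).real {ω | ((m + 1 : ℕ) : ℝ) * (r : ℝ) - (1 - (r : ℝ)) < (B r ω : ℝ)} =
          1 - binomialCDF (m + 1) i (((i + 1 : ℕ) : ℝ) / (m + 2)) := by
      intro r i hr
      rw [← hr, ← hasLaw_binomial_real_lt (hB r) i]
      have : ((m + 1 : ℕ) : ℝ) * (r : ℝ) - (1 - (r : ℝ)) = i := by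
        rw [hr]; push_cast; field_simp; ring
      rw [this]
    have hmono : ∀ l, k ≤ l → l ≤ m →
        binomialCDF (m + 1) k (((k + 1 : ℕ) : ℝ) / (m + 2)) ≤
          binomialCDF (m + 1) l (((l + 1 : ℕ) : ℝ) / (m + 2)) := by
      intro l hkl
      induction l, hkl using Nat.le_induction with
      | base => exact fun _ => le_rfl
      | succ l hkl ih =>
        exact fun h => (ih (by omega)).trans (binomialCDF_step_mean m l h)
    simp only [key p k hp, key q l hq]
    linarith [hmono l hkl (by omega)]
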